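/- Let $S$ be either a regular local ring of Krull dimension $2$ with maximal ideal $\mathfrak n$, or a polynomial ring in two variables over a field with $\mathfrak n$ the ideal generated by the variables; put $k=S/\mathfrak n$. Let $x_1,x_2$ be a minimal system of generators of $\mathfrak n$ (consisting of homogeneous elements in the polynomial case), let $K$ be the Koszul complex of $S$ on $x_1,x_2$, and let $\mathcal Z_i\subseteq K_i$ be its module of $i$-cycles. For an ideal $\mathfrak a$ of $S$ and $i\ge 1$ let $\rho_i(\mathfrak a)$ be the smallest positive integer $r$ such that $\mathcal Z_i\cap \mathfrak a^mK_i\subseteq \mathfrak a^{m-r}\mathcal Z_i$ for all $m\ge r$, and let $\rho(\mathfrak a)=\max\{\rho_1(\mathfrak a),\rho_2(\mathfrak a)\}$ be the Koszul Artin–Rees number of $\mathfrak a$. Then, for every ideal $\mathfrak a$ of $S$, one has $\rho(\mathfrak a)=1$. Moreover, for all $m\ge 1$ and all $i\ge 1$ the map $\mathrm{Tor}_i^S(S/\mathfrak a^m,k)\to\mathrm{Tor}_i^S(S/\mathfrak a^{m-1},k)$ induced by the projection $S/\mathfrak a^m\to S/\mathfrak a^{m-1}$ is zero, and $(\mathfrak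 a^m:x_j)\subseteq\mathfrak a^{m-1}$ for all $m\ge 1$ and $j=1,2$. -/

import Mathlib

universe u

open CategoryTheory

noncomputable section

namespace KoszulAR

/-- The differential of the Koszul complex `K(x; S)` of `x₁, …, x_d`, whose underlying algebra is
the exterior algebra of `S^d`: contraction with the linear form `v ↦ ∑ i, v i * x i`, so that
`∂(e_{i₁} ∧ ⋯ ∧ e_{i_l}) = ∑ j, (-1)^(j+1) x_{i_j} e_{i₁} ∧ ⋯ ê_{i_j} ⋯ ∧ e_{i_l}`. -/
def differential {S : Type u} [CommRing S] {d : ℕ} (x : Fin d → S) :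
    ExteriorAlgebra S (Fin d → S) →ₗ[S] ExteriorAlgebra S (Fin d → S) :=
  CliffordAlgebra.contractLeft (Q := (0 : QuadraticForm S (Fin d → S)))
    (Fintype.linearCombination S x)

theorem differential_ι {S : Type u} [CommRing S] {d : ℕ} (x : Fin d → S) (v : Fin d → S) :
    differential x (ExteriorAlgebra.ι S v) = algebraMap S _ (∑ i, v i * x i) := by
  have h := CliffordAlgebra.contractLeft_ι (Q := (0 : QuadraticForm S (Fin d → S)))
    (Fintype.linearCombination S x) v
  rw [Fintype.linearCombination_apply] at h
  exact h

theorem differential_ι_mul {S : Type u} [CommRing S] {d : ℕ} (x : Fin d → S) (v : Fin d → S)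
    (w : ExteriorAlgebra S (Fin d → S)) :
    differential x (ExteriorAlgebra.ι S v * w) =
      (∑ i, v i * x i) • w - ExteriorAlgebra.ι S v * differential x w := by
  have h := CliffordAlgebra.contractLeft_ι_mul (Q := (0 : QuadraticForm S (Fin d → S)))
    (Fintype.linearCombination S x) v w
  rw [Fintype.linearCombination_apply] at h
  exact h

theorem differential_differential {S : Type u} [CommRing S] {d : ℕ} (x : Fin d → S)
    (w : ExteriorAlgebra S (Fin d → S)) : differential x (differential x w) = 0 :=
  CliffordAlgebra.contractLeft_contractLeft _ _

/-- The module `K_i = ⋀^i S^d` of `i`-chains of the Koszul complex, inside the exterior algebra. -/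
def chains (S : Type u) [CommRing S] (d i : ℕ) : Submodule S (ExteriorAlgebra S (Fin d → S)) :=
  ⋀[S]^i (Fin d → S)

/-- The module `Z_i` of `i`-cycles of the Koszul complex of `x`. -/
def cycles {S : Type u} [CommRing S] {d : ℕ} (x : Fin d → S) (i : ℕ) :
    Submodule S (ExteriorAlgebra S (Fin d → S)) :=
  chains S d i ⊓ LinearMap.ker (differential x)

/-- `r` is admissible in degree `i` for the ideal `c`: for all `m ≥ r`,
`Z_i ∩ c^m K_i ⊆ c^(m-r) Z_i`. -/
def IsAdmissible {S : Type u} [CommRing S] {d : ℕ} (x : Fin d → S) (c : Ideal S) (i r : ℕ) :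
    Prop :=
  ∀ m : ℕ, r ≤ m → cycles x i ⊓ c ^ m • chains S d i ≤ c ^ (m - r) • cycles x i

/-- `ρ_i(c)`: the smallest positive integer that is admissible in degree `i`
(and `⊤` if there is none). -/
def rhoDeg {S : Type u} [CommRing S] {d : ℕ} (x : Fin d → S) (c : Ideal S) (i : ℕ) : ℕ∞ :=
  ⨅ (r : ℕ) (_ : 1 ≤ r ∧ IsAdmissible x c i r), (r : ℕ∞)

/-- The Koszul Artin–Rees number `ρ(c) = max (ρ_1(c), …, ρ_d(c))`, computed with the Koszul complex
of `x₁, …, x_d`. -/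
def rho {S : Type u} [CommRing S] {d : ℕ} (x : Fin d → S) (c : Ideal S) : ℕ∞ :=
  ⨆ i ∈ Finset.Icc 1 d, rhoDeg x c i

/-- The map `Tor_i^S(S/a, S/n) → Tor_i^S(S/b, S/n)` induced by the projection `S/a → S/b`,
for ideals `a ⊆ b`. -/
def torMap {S : Type u} [CommRing S] (n : Ideal S) {a b : Ideal S} (h : a ≤ b) (i : ℕ) :
    ((Tor (ModuleCat.{u} S) i).obj (ModuleCat.of S (S ⧸ a))).obj (ModuleCat.of S (S ⧸ n)) ⟶
      ((Tor (ModuleCat.{u} S) i).obj (ModuleCat.of S (S ⧸ b))).obj (ModuleCat.of S (S ⧸ n)) :=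
  ((Tor (ModuleCat.{u} S) i).map
    (ModuleCat.ofHom (Ideal.Quotient.factorₐ S h).toLinearMap)).app (ModuleCat.of S (S ⧸ n))

end KoszulAR

end

/-! The engine is that every `S ⧸ (x j)` is a principal ideal ring. Lifting a generator of the image
of `a` gives `g ∈ a` with `a ⊆ (g) + (x j)`, and by induction `a ^ m ⊆ (g ^ m) + x j * a ^ (m - 1)`.
As `x j` is prime and can be assumed not to divide `g` unless `g = 0`, cancelling `x j` yields the
colon inclusion (`colon_pow_singleton_le`).

The rest reads this off the Koszul complex. `Z_2` vanishes and `Z_1` is generated by `(-x 1, x 0)`;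
if `t • (-x 1, x 0)` has coordinates in `a ^ m`, then `t * x 0 ∈ a ^ m`, so `t ∈ a ^ (m - 1)`: hence
`ρ = 1`. The same inclusion kills the map on `Tor_2`. For `Tor_1`, a relation on `x` modulo `a ^ m`
must be a Koszul relation modulo `a ^ (m - 1)` (`IsPrimePair.exists_sub_mem`). Both kinds of ring
enter only through `IsPrimePair` and the maximality of `(x 0, x 1)`. -/

noncomputable section

namespace KoszulAR

/-! ### Colon ideals of powers, and relations modulo powers. -/

section ColonIdeals

variable {S : Type u} [CommRing S]

theorem exists_mem_forall_mem_eq_mul_add_mul (x : S) [IsPrincipalIdealRing (S ⧸ Ideal.span {x})]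
    (a : Ideal S) :
    ∃ g ∈ a, (g = 0 ∨ ¬ x ∣ g) ∧ ∀ y ∈ a, ∃ s h : S, y = g * s + x * h := by
  obtain ⟨b, hb⟩ := (IsPrincipalIdealRing.principal (a.map (Ideal.Quotient.mk (Ideal.span {x})))).1
  have hba : b ∈ a.map (Ideal.Quotient.mk (Ideal.span {x})) :=
    hb ▸ Submodule.mem_span_singleton_self b
  obtain ⟨g, hg, rfl⟩ :=
    (Ideal.mem_map_iff_of_surjective _ Ideal.Quotient.mk_surjective).1 hba
  have key : ∀ y ∈ a, ∃ s h : S, y = g * s + x * h := by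
    intro y hy
    have h1 := Ideal.mem_map_of_mem (Ideal.Quotient.mk (Ideal.span {x})) hy
    rw [hb] at h1
    obtain ⟨s, hs⟩ := Ideal.mem_span_singleton'.1 h1
    obtain ⟨s, rfl⟩ := Ideal.Quotient.mk_surjective s
    rw [← map_mul, eq_comm, Ideal.Quotient.mk_eq_mk_iff_sub_mem,
      Ideal.mem_span_singleton] at hs
    obtain ⟨h, hh⟩ := hs
    exact ⟨s, h, by linear_combination hh⟩
  by_cases hx : x ∣ g
  -- If `x ∣ g`, the image of `a` modulo `x` is zero, so `0` serves as generator.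
  · obtain ⟨t, rfl⟩ := hx
    refine ⟨0, a.zero_mem, Or.inl rfl, fun y hy => ?_⟩
    obtain ⟨s, h, rfl⟩ := key y hy
    exact ⟨0, t * s + h, by ring⟩
  · exact ⟨g, hg, Or.inr hx, key⟩

/-- Multiply `g * s + x * t` by `g ^ m * s' + x * w'`. The clause `g * w ∈ a ^ m` is what the
induction consumes; carrying it treats `m = 0`, where `m - 1` truncates, together with `m ≥ 1`. -/
theorem exists_eq_pow_mul_add_mul {x g : S} {a : Ideal S} (hg : g ∈ a)
    (h : ∀ y ∈ a, ∃ s h : S, y = g * s + x * h) (m : ℕ) {z : S} (hz : z ∈ a ^ m) :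
    ∃ s w : S, w ∈ a ^ (m - 1) ∧ g * w ∈ a ^ m ∧ z = g ^ m * s + x * w := by
  induction m generalizing z with
  | zero => exact ⟨z, 0, zero_mem _, by simp, by simp⟩
  | succ m ih =>
    simp only [Nat.add_sub_cancel]
    suffices H : ∃ s w : S, w ∈ a ^ m ∧ z = g ^ (m + 1) * s + x * w by
      obtain ⟨s, w, hw, rfl⟩ := H
      exact ⟨s, w, hw, by rw [pow_succ']; exact Ideal.mul_mem_mul hg hw, rfl⟩
    rw [pow_succ'] at hz
    refine Submodule.mul_induction_on hz (fun y hy z' hz' => ?_) ?_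
    · obtain ⟨s, t, rfl⟩ := h y hy
      obtain ⟨s', w', -, hgw, hz''⟩ := ih hz'
      refine ⟨s * s', s * (g * w') + t * z',
        add_mem (Ideal.mul_mem_left _ _ hgw) (Ideal.mul_mem_left _ _ hz'), ?_⟩
      rw [add_mul, mul_add, show g * s * z' = g * s * (g ^ m * s' + x * w') by rw [← hz'']]
      ring
    · rintro _ _ ⟨s, w, hw, rfl⟩ ⟨s', w', hw', rfl⟩
      exact ⟨s + s', w + w', add_mem hw hw', by ring⟩

theorem colon_pow_singleton_le [IsDomain S] {x : S} (hx : Prime x)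
    [IsPrincipalIdealRing (S ⧸ Ideal.span {x})] (a : Ideal S) {m : ℕ} (hm : 1 ≤ m) :
    (a ^ m).colon {x} ≤ a ^ (m - 1) := by
  intro f hf
  rw [Submodule.mem_colon_singleton, smul_eq_mul] at hf
  obtain ⟨g, hg, hxg, h⟩ := exists_mem_forall_mem_eq_mul_add_mul x a
  obtain ⟨s, w, hw, -, hfw⟩ := exists_eq_pow_mul_add_mul hg h m hf
  rcases hxg with rfl | hxg
  · rw [zero_pow (by lia), zero_mul, zero_add, mul_comm] at hfw
    rwa [mul_left_cancel₀ hx.ne_zero hfw]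
  · have hdvd : x ∣ g ^ m * s := ⟨f - w, by linear_combination -hfw⟩
    obtain ⟨t, rfl⟩ := (hx.dvd_or_dvd hdvd).resolve_left fun hh => hxg (hx.dvd_of_dvd_pow hh)
    have : f = g ^ m * t + w := mul_left_cancel₀ hx.ne_zero (by linear_combination hfw)
    rw [this]
    exact add_mem (Ideal.mul_mem_right _ _ (Ideal.pow_le_pow_right (Nat.sub_le m 1)
      (Ideal.pow_mem_pow hg m))) hw

/-- A pair of generators of a maximal ideal with the divisibility properties of a regular system of
parameters of a two-dimensional regular ring. -/
structure IsPrimePair (x : Fin 2 → S) : Prop where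
  prime : ∀ j, Prime (x j)
  not_dvd : ¬ x 0 ∣ x 1
  isPrincipalIdealRing : ∀ j, IsPrincipalIdealRing (S ⧸ Ideal.span {x j})

variable [IsDomain S] {x : Fin 2 → S}

theorem IsPrimePair.colon_le (hx : IsPrimePair x) (a : Ideal S) {m : ℕ} (hm : 1 ≤ m) (j : Fin 2) :
    (a ^ m).colon {x j} ≤ a ^ (m - 1) :=
  have := hx.isPrincipalIdealRing j
  colon_pow_singleton_le (hx.prime j) a hm

theorem IsPrimePair.exists_eq_mul (hx : IsPrimePair x) {u v : S} (h : u * x 0 + v * x 1 = 0) :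
    ∃ t, u = -(t * x 1) ∧ v = t * x 0 := by
  have hdvd : x 0 ∣ v * x 1 := ⟨-u, by linear_combination h⟩
  obtain ⟨t, rfl⟩ := ((hx.prime 0).dvd_or_dvd hdvd).resolve_right hx.not_dvd
  refine ⟨t, mul_right_cancel₀ (hx.prime 0).ne_zero ?_, mul_comm _ _⟩
  linear_combination h

theorem mem_span_range_fin_two {R : Type u} [CommRing R] {x : Fin 2 → R} {w : R} :
    w ∈ Ideal.span (Set.range x) ↔ ∃ p q, w = p * x 0 + q * x 1 := by
  rw [Ideal.mem_span_range_iff_exists_fun]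
  constructor
  · rintro ⟨c, rfl⟩
    exact ⟨c 0, c 1, by simp [Fin.sum_univ_two]⟩
  · rintro ⟨p, q, rfl⟩
    exact ⟨![p, q], by simp [Fin.sum_univ_two]⟩

theorem mem_span_range_mul_fin_two {R : Type u} [CommRing R] {x : Fin 2 → R} {b : Ideal R} {w : R}
    (hw : w ∈ Ideal.span (Set.range x) * b) : ∃ p ∈ b, ∃ q ∈ b, w = p * x 0 + q * x 1 := by
  refine Submodule.mul_induction_on hw (fun y hy z hz => ?_) ?_
  · obtain ⟨p, q, rfl⟩ := mem_span_range_fin_two.1 hy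
    exact ⟨p * z, b.mul_mem_left _ hz, q * z, b.mul_mem_left _ hz, by ring⟩
  · rintro _ _ ⟨p, hp, q, hq, rfl⟩ ⟨p', hp', q', hq', rfl⟩
    exact ⟨p + p', add_mem hp hp', q + q', add_mem hq hq', by ring⟩

/-- Relations on `x` modulo `a ^ m` are Koszul relations modulo `a ^ (m - 1)`. -/
theorem IsPrimePair.exists_sub_mem (hx : IsPrimePair x)
    (hmax : (Ideal.span (Set.range x)).IsMaximal) (a : Ideal S) {m : ℕ} (hm : 1 ≤ m) {u v : S}
    (h : u * x 0 + v * x 1 ∈ a ^ m) :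
    ∃ t, u + t * x 1 ∈ a ^ (m - 1) ∧ v - t * x 0 ∈ a ^ (m - 1) := by
  obtain ⟨n, rfl⟩ : ∃ n, m = n + 1 := ⟨m - 1, by lia⟩
  simp only [Nat.add_sub_cancel]
  by_cases ha : a ≤ Ideal.span (Set.range x)
  -- Here `a ^ (n + 1)` lies in `(x 0, x 1) * a ^ n`; subtracting coefficients from `a ^ n` leaves
  -- an exact syzygy.
  · rw [pow_succ'] at h
    obtain ⟨p, hp, q, hq, hpq⟩ := mem_span_range_mul_fin_two (Ideal.mul_mono_left ha h)
    obtain ⟨t, ht, ht'⟩ := hx.exists_eq_mul (u := u - p) (v := v - q) (by linear_combination hpq)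
    exact ⟨t, by rwa [show u + t * x 1 = p by linear_combination ht],
      by rwa [show v - t * x 0 = q by linear_combination ht']⟩
  · have htop : a ^ n ⊔ Ideal.span (Set.range x) = ⊤ := by
      refine Ideal.pow_sup_eq_top ?_
      rw [sup_comm]
      exact hmax.out.2 _ (left_lt_sup.2 ha)
    obtain ⟨α, hα, ν, hν, hsum⟩ := Submodule.mem_sup.1 (htop ▸ Submodule.mem_top : (1 : S) ∈ _)
    obtain ⟨p, q, rfl⟩ := mem_span_range_fin_two.1 hν
    have hw := Ideal.pow_le_pow_right (Nat.le_succ n) h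
    -- Since `1 = α + p * x 0 + q * x 1` with `α ∈ a ^ n`, this is the Koszul contracting homotopy
    -- applied to `(u, v)`.
    refine ⟨p * v - q * u, ?_, ?_⟩
    · rw [show u + (p * v - q * u) * x 1 = u * α + p * (u * x 0 + v * x 1) by
        linear_combination (-u) * hsum]
      exact add_mem (Ideal.mul_mem_left _ _ hα) (Ideal.mul_mem_left _ _ hw)
    · rw [show v - (p * v - q * u) * x 0 = v * α + q * (u * x 0 + v * x 1) by
        linear_combination (-v) * hsum]
      exact add_mem (Ideal.mul_mem_left _ _ hα) (Ideal.mul_mem_left _ _ hw)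

end ColonIdeals

/-! ### Koszul cycles and the Artin–Rees number. -/

section ArtinRees

variable {S : Type u} [CommRing S]

theorem chains_one (d : ℕ) :
    chains S d 1 = LinearMap.range (ExteriorAlgebra.ι S (M := Fin d → S)) :=
  pow_one _

theorem exists_mem_of_ι_mem_smul_chains_one {d : ℕ} {c : Ideal S} {v : Fin d → S}
    (hv : ExteriorAlgebra.ι S v ∈ c • chains S d 1) (j : Fin d) : v j ∈ c := by
  let f : ExteriorAlgebra S (Fin d → S) →ₗ[S] S :=
    LinearMap.proj j ∘ₗ ExteriorAlgebra.ιInv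
  have h : f (ExteriorAlgebra.ι S v) ∈ c • (chains S d 1).map f := by
    rw [← Submodule.map_smul'']
    exact Submodule.mem_map_of_mem hv
  have hf : f (ExteriorAlgebra.ι S v) = v j := by
    simp [f, ExteriorAlgebra.ι_leftInverse v]
  rw [hf] at h
  exact (Submodule.smul_le.2 fun r hr n _ => c.mul_mem_right n hr : c • (chains S d 1).map f ≤ c) h

theorem exists_eq_smul_of_mem_chains_two {w : ExteriorAlgebra S (Fin 2 → S)}
    (hw : w ∈ chains S 2 2) :
    ∃ c : S, w = c • (ExteriorAlgebra.ι S (Pi.single 0 1) *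
      ExteriorAlgebra.ι S (Pi.single 1 1)) := by
  have hsum (v : Fin 2 → S) : ExteriorAlgebra.ι S v =
      v 0 • ExteriorAlgebra.ι S (Pi.single 0 1) + v 1 • ExteriorAlgebra.ι S (Pi.single 1 1) := by
    rw [← map_smul, ← map_smul, ← map_add]
    congr 1
    ext i
    fin_cases i <;> simp
  have hswap := ExteriorAlgebra.ι_add_mul_swap (R := S) (Pi.single 0 1 : Fin 2 → S) (Pi.single 1 1)
  have hw' : w ∈ LinearMap.range (ExteriorAlgebra.ι S (M := Fin 2 → S)) *
      LinearMap.range (ExteriorAlgebra.ι S (M := Fin 2 → S)) := by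
    rw [← pow_two]
    exact hw
  refine Submodule.mul_induction_on hw' ?_ ?_
  · rintro _ ⟨v, rfl⟩ _ ⟨v', rfl⟩
    refine ⟨v 0 * v' 1 - v 1 * v' 0, ?_⟩
    rw [hsum v, hsum v']
    simp only [add_mul, mul_add, smul_mul_smul_comm, ExteriorAlgebra.ι_sq_zero, smul_zero,
      eq_neg_of_add_eq_zero_right hswap, smul_neg, sub_smul]
    abel
  · rintro _ _ ⟨c, rfl⟩ ⟨c', rfl⟩
    exact ⟨c + c', (add_smul _ _ _).symm⟩

variable [IsDomain S] {x : Fin 2 → S}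

theorem IsPrimePair.cycles_two (hx : IsPrimePair x) : cycles x 2 = ⊥ := by
  rw [eq_bot_iff]
  rintro w ⟨hw, hw'⟩
  obtain ⟨c, rfl⟩ := exists_eq_smul_of_mem_chains_two hw
  rw [SetLike.mem_coe, LinearMap.mem_ker, map_smul, differential_ι_mul, differential_ι,
    ← Algebra.commutes, ← Algebra.smul_def] at hw'
  rw [← map_smul, ← map_smul, ← map_sub, ← map_smul, ExteriorAlgebra.ι_eq_zero_iff] at hw'
  -- The second coordinate of the boundary of `c • (e₀ ∧ e₁)` is `c * x 0`.
  have h1 := congrFun hw' 1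
  simp only [Fin.sum_univ_two, Pi.smul_apply, Pi.sub_apply, Pi.zero_apply, smul_eq_mul] at h1
  simp [(hx.prime 0).ne_zero] at h1
  simp [h1]

theorem IsPrimePair.isAdmissible_one (hx : IsPrimePair x) (a : Ideal S) :
    IsAdmissible x a 1 1 := by
  rintro m hm w ⟨⟨hw, hw'⟩, hwm⟩
  rw [chains_one] at hw
  obtain ⟨v, rfl⟩ := hw
  rw [SetLike.mem_coe, LinearMap.mem_ker, differential_ι, ExteriorAlgebra.algebraMap_eq_zero_iff,
    Fin.sum_univ_two] at hw'
  obtain ⟨t, h0, h1⟩ := hx.exists_eq_mul hw'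
  have ht : t ∈ a ^ (m - 1) := by
    refine hx.colon_le a hm 0 ?_
    rw [Submodule.mem_colon_singleton, smul_eq_mul, ← h1]
    exact exists_mem_of_ι_mem_smul_chains_one hwm 1
  have hv : v = t • ![-x 1, x 0] := by
    ext i
    fin_cases i <;> simp [h0, h1]
  rw [hv, map_smul]
  refine Submodule.smul_mem_smul ht ⟨?_, ?_⟩
  · rw [chains_one]
    exact ⟨_, rfl⟩
  · rw [SetLike.mem_coe, LinearMap.mem_ker, differential_ι]
    simp [Fin.sum_univ_two, mul_comm]

theorem one_le_rhoDeg {R : Type u} [CommRing R] {d : ℕ} (x : Fin d → R) (c : Ideal R) (i : ℕ) :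
    1 ≤ rhoDeg x c i :=
  le_iInf₂ fun r hr => by exact_mod_cast hr.1

theorem rhoDeg_le {R : Type u} [CommRing R] {d i r : ℕ} {x : Fin d → R} {c : Ideal R} (hr : 1 ≤ r)
    (h : IsAdmissible x c i r) : rhoDeg x c i ≤ r :=
  iInf₂_le r ⟨hr, h⟩

theorem IsPrimePair.rho_eq_one (hx : IsPrimePair x) (a : Ideal S) : rho x a = 1 := by
  refine le_antisymm (iSup₂_le fun i hi => ?_) ?_
  · refine (rhoDeg_le le_rfl ?_).trans_eq Nat.cast_one
    obtain rfl | rfl : i = 1 ∨ i = 2 := by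
      rw [Finset.mem_Icc] at hi
      lia
    · exact hx.isAdmissible_one a
    · intro m _
      rw [hx.cycles_two, bot_inf_eq]
      exact bot_le
  · exact (one_le_rhoDeg x a 1).trans (le_iSup₂_of_le 1 (by simp) le_rfl)

end ArtinRees

/-! ### The Koszul resolution and the maps on Tor. -/

section Tor

open HomologicalComplex Limits

theorem homologyMap_eq_zero_of_forall_exists {R : Type u} [Ring R] {ι : Type*}
    {c : ComplexShape ι} {K L : HomologicalComplex (ModuleCat.{u} R) c} (φ : K ⟶ L) (i j l : ι)
    (_ : c.prev j = i) (_ : c.next j = l)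
    (h : ∀ z : K.X j, K.d j l z = 0 → ∃ y : L.X i, L.d i j y = φ.f j z) :
    homologyMap φ j = 0 := by
  rw [← cancel_epi (K.homologyπ j), homologyπ_naturality, comp_zero]
  ext z
  obtain ⟨y, hy⟩ := h (K.iCycles j z) (by
    rw [← ConcreteCategory.comp_apply, K.iCycles_d]
    rfl)
  have hz : cyclesMap φ j z = L.toCycles i j y := by
    refine (ModuleCat.mono_iff_injective (L.iCycles j)).1 inferInstance ?_
    rw [← ConcreteCategory.comp_apply, ← ConcreteCategory.comp_apply, cyclesMap_i, L.toCycles_i,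
      ConcreteCategory.comp_apply]
    exact hy.symm
  rw [ModuleCat.hom_comp, LinearMap.comp_apply]
  erw [hz]
  rw [← ConcreteCategory.comp_apply, L.toCycles_comp_homologyπ]
  rfl

variable {S : Type u} [CommRing S]

/-- The modules of the Koszul resolution of a pair of elements. -/
def koszulX (S : Type u) [CommRing S] : ℕ → ModuleCat.{u} S
  | 0 => ModuleCat.of S S
  | 1 => ModuleCat.of S (S × S)
  | 2 => ModuleCat.of S S
  | _ + 3 => ModuleCat.of S PUnit

/-- The linear form `(u, v) ↦ u * x 0 + v * x 1`. -/
def koszulD₁ (x : Fin 2 → S) : S × S →ₗ[S] S :=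
  (LinearMap.toSpanSingleton S S (x 0)).coprod (LinearMap.toSpanSingleton S S (x 1))

/-- The map `t ↦ (-(t * x 1), t * x 0)`. -/
def koszulD₂ (x : Fin 2 → S) : S →ₗ[S] S × S :=
  LinearMap.toSpanSingleton S (S × S) (-x 1, x 0)

/-- The differentials of the Koszul resolution of a pair of elements. -/
def koszulD (x : Fin 2 → S) : ∀ n, koszulX S (n + 1) ⟶ koszulX S n
  | 0 => ModuleCat.ofHom (koszulD₁ x)
  | 1 => ModuleCat.ofHom (koszulD₂ x)
  | _ + 2 => 0

@[simp]
theorem koszulD₁_apply (x : Fin 2 → S) (v : S × S) : koszulD₁ x v = v.1 * x 0 + v.2 * x 1 := rfl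

@[simp]
theorem koszulD₂_apply (x : Fin 2 → S) (t : S) : koszulD₂ x t = (-(t * x 1), t * x 0) := by
  simp [koszulD₂]

theorem koszulD₁_comp_koszulD₂ (x : Fin 2 → S) : koszulD₁ x ∘ₗ koszulD₂ x = 0 := by
  ext
  simp
  ring

/-- The Koszul complex of a pair of elements as a chain complex. -/
def koszulComplex (x : Fin 2 → S) : ChainComplex (ModuleCat.{u} S) ℕ :=
  ChainComplex.of (koszulX S) (koszulD x) (by
    rintro (_ | n)
    · change ModuleCat.ofHom (koszulD₂ x) ≫ ModuleCat.ofHom (koszulD₁ x) = 0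
      rw [← ModuleCat.ofHom_comp, koszulD₁_comp_koszulD₂]
      rfl
    · exact zero_comp)

theorem koszulComplex_d (x : Fin 2 → S) (n : ℕ) : (koszulComplex x).d (n + 1) n = koszulD x n :=
  ChainComplex.of_d _ _ n

theorem koszulX_projective : ∀ n, Projective (koszulX S n)
  | 0 => inferInstanceAs (Projective (ModuleCat.of S S))
  | 1 => inferInstanceAs (Projective (ModuleCat.of S (S × S)))
  | 2 => inferInstanceAs (Projective (ModuleCat.of S S))
  | _ + 3 => inferInstanceAs (Projective (ModuleCat.of S PUnit.{u + 1}))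

variable [IsDomain S] {x : Fin 2 → S}

theorem IsPrimePair.koszulComplex_exactAt_succ (hx : IsPrimePair x) (n : ℕ) :
    (koszulComplex x).ExactAt (n + 1) := by
  rw [HomologicalComplex.exactAt_iff' _ (n + 1 + 1) (n + 1) n (by simp) (by simp),
    ShortComplex.moduleCat_exact_iff]
  dsimp only [HomologicalComplex.sc', HomologicalComplex.shortComplexFunctor']
  rw [koszulComplex_d, koszulComplex_d]
  match n with
  | 0 =>
    intro (v : S × S) (hv : koszulD₁ x v = 0)
    obtain ⟨t, h0, h1⟩ := hx.exists_eq_mul (u := v.1) (v := v.2) hv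
    exact ⟨t, (koszulD₂_apply x t).trans (Prod.ext h0.symm h1.symm)⟩
  | 1 =>
    intro (t : S) (ht : koszulD₂ x t = 0)
    rw [koszulD₂_apply] at ht
    have ht0 : t = 0 := by
      simpa [(hx.prime 0).ne_zero] using congrArg Prod.snd ht
    exact ⟨0, (map_zero _).trans ht0.symm⟩
  | n + 2 =>
    intro (v : PUnit) _
    exact ⟨0, Subsingleton.elim (α := PUnit) _ _⟩

theorem koszulD_zero_comp_mkQ {R : Type u} [CommRing R] (x : Fin 2 → R) :
    koszulD x 0 ≫ ModuleCat.ofHom (Ideal.span (Set.range x)).mkQ = 0 := by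
  ext (v : R × R)
  refine (Submodule.Quotient.mk_eq_zero _).2 ?_
  exact mem_span_range_fin_two.2 ⟨v.1, v.2, rfl⟩

/-- The Koszul resolution of `S ⧸ (x 0, x 1)`. -/
def IsPrimePair.koszulResolution (hx : IsPrimePair x) :
    ProjectiveResolution (ModuleCat.of S (S ⧸ Ideal.span (Set.range x))) where
  complex := koszulComplex x
  projective := koszulX_projective
  π := (ChainComplex.toSingle₀Equiv _ _).symm
    ⟨ModuleCat.ofHom (Ideal.span (Set.range x)).mkQ, by
      rw [koszulComplex_d]
      exact koszulD_zero_comp_mkQ x⟩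
  quasiIso := ⟨fun n => by
    cases n
    -- In degree zero the claim is exactness of `K_1 ⟶ K_0 ⟶ S ⧸ (x 0, x 1) ⟶ 0`.
    · rw [ChainComplex.quasiIsoAt₀_iff, ShortComplex.quasiIso_iff_of_zeros' _ rfl rfl rfl]
      refine (ShortComplex.exact_and_epi_g_iff_of_iso (S₂ := ShortComplex.mk
        (koszulD x 0) (ModuleCat.ofHom (Ideal.span (Set.range x)).mkQ)
        (koszulD_zero_comp_mkQ x)) ?_).2 ⟨?_, ?_⟩
      · exact ShortComplex.isoMk (Iso.refl _) (Iso.refl _) (Iso.refl _)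
          ((Category.id_comp _).trans ((koszulComplex_d x 0).symm.trans (Category.comp_id _).symm))
          (by
            refine (Category.id_comp (ModuleCat.ofHom _)).trans
              (Eq.trans ?_ (Category.comp_id _).symm)
            exact (ChainComplex.toSingle₀Equiv_symm_apply_f_zero (C := koszulComplex x)
              (ModuleCat.ofHom (Ideal.span (Set.range x)).mkQ) _).symm)
      · rw [ShortComplex.moduleCat_exact_iff]
        intro (s : S) hs
        obtain ⟨p, q, rfl⟩ := mem_span_range_fin_two.1 ((Submodule.Quotient.mk_eq_zero _).1 hs)
        exact ⟨((p, q) : S × S), rfl⟩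
      · exact (ModuleCat.epi_iff_surjective _).2 (Submodule.mkQ_surjective _)
    · rw [quasiIsoAt_iff_exactAt']
      · exact hx.koszulComplex_exactAt_succ _
      · exact ChainComplex.exactAt_succ_single_obj _ _⟩

section

open scoped TensorProduct

theorem exists_eq_tmul_one {R M : Type*} [CommRing R] [AddCommGroup M] [Module R M]
    (z : M ⊗[R] R) : ∃ u : M, z = u ⊗ₜ 1 :=
  ⟨TensorProduct.rid R M z, ((TensorProduct.rid R M).symm_apply_apply z).symm⟩

theorem exists_eq_tmul_add_tmul {R M : Type*} [CommRing R] [AddCommGroup M] [Module R M]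
    (z : M ⊗[R] (R × R)) : ∃ u v : M, z = u ⊗ₜ (1, 0) + v ⊗ₜ (0, 1) := by
  induction z with
  | zero => exact ⟨0, 0, by simp⟩
  | tmul u r =>
    refine ⟨r.1 • u, r.2 • u, ?_⟩
    rw [TensorProduct.smul_tmul, TensorProduct.smul_tmul, ← TensorProduct.tmul_add]
    simp
  | add z z' h h' =>
    obtain ⟨u, v, rfl⟩ := h
    obtain ⟨u', v', rfl⟩ := h'
    exact ⟨u + u', v + v', by simp only [TensorProduct.add_tmul]; abel⟩

theorem IsPrimePair.exists_lTensor_koszulD₂ (hx : IsPrimePair x)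
    (hmax : (Ideal.span (Set.range x)).IsMaximal) (a : Ideal S) {m : ℕ} (hm : 1 ≤ m)
    (z : (S ⧸ a ^ m) ⊗[S] (S × S)) (hz : (koszulD₁ x).lTensor (S ⧸ a ^ m) z = 0) :
    ∃ y : (S ⧸ a ^ (m - 1)) ⊗[S] S, (koszulD₂ x).lTensor (S ⧸ a ^ (m - 1)) y =
      (Ideal.Quotient.factorₐ S
        (Ideal.pow_le_pow_right (I := a) (Nat.sub_le m 1))).toLinearMap.rTensor (S × S) z := by
  obtain ⟨u, v, rfl⟩ := exists_eq_tmul_add_tmul z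
  obtain ⟨u, rfl⟩ := Ideal.Quotient.mk_surjective u
  obtain ⟨v, rfl⟩ := Ideal.Quotient.mk_surjective v
  have h := congrArg (TensorProduct.rid S (S ⧸ a ^ m)) hz
  simp only [map_add, LinearMap.lTensor_tmul, koszulD₁_apply, TensorProduct.rid_tmul, map_zero,
    Algebra.smul_def, Ideal.Quotient.algebraMap_eq] at h
  simp only [← map_add, ← map_mul] at h
  rw [Ideal.Quotient.eq_zero_iff_mem] at h
  obtain ⟨t, h0, h1⟩ := hx.exists_sub_mem hmax a hm (u := u) (v := v)
    (by convert h using 1; ring)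
  refine ⟨Ideal.Quotient.mk _ t ⊗ₜ 1, ?_⟩
  have hsplit : ((-x 1, x 0) : S × S) = (-x 1) • (1, 0) + x 0 • (0, 1) := by simp
  have hu : Ideal.Quotient.mk (a ^ (m - 1)) u = -x 1 • Ideal.Quotient.mk (a ^ (m - 1)) t := by
    rw [Algebra.smul_def, Ideal.Quotient.algebraMap_eq, ← map_mul,
      Ideal.Quotient.mk_eq_mk_iff_sub_mem]
    convert h0 using 1
    ring
  have hv : Ideal.Quotient.mk (a ^ (m - 1)) v = x 0 • Ideal.Quotient.mk (a ^ (m - 1)) t := by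
    rw [Algebra.smul_def, Ideal.Quotient.algebraMap_eq, ← map_mul,
      Ideal.Quotient.mk_eq_mk_iff_sub_mem]
    convert h1 using 1
    ring
  simp only [LinearMap.lTensor_tmul, koszulD₂_apply, one_mul, map_add, LinearMap.rTensor_tmul,
    AlgHom.toLinearMap_apply, Ideal.Quotient.factorₐ_apply_mk, hu, hv, hsplit,
    TensorProduct.tmul_add, TensorProduct.smul_tmul]

/-- The second coordinate of the cycle condition says that a representative `t` satisfies `t * x 0 ∈
a ^ m`, so the colon inclusion applies. -/
theorem IsPrimePair.rTensor_eq_zero (hx : IsPrimePair x) (a : Ideal S) {m : ℕ} (hm : 1 ≤ m)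
    (z : (S ⧸ a ^ m) ⊗[S] S) (hz : (koszulD₂ x).lTensor (S ⧸ a ^ m) z = 0) :
    (Ideal.Quotient.factorₐ S
      (Ideal.pow_le_pow_right (I := a) (Nat.sub_le m 1))).toLinearMap.rTensor S z = 0 := by
  obtain ⟨t, rfl⟩ := exists_eq_tmul_one z
  obtain ⟨t, rfl⟩ := Ideal.Quotient.mk_surjective t
  have h := congrArg (TensorProduct.rid S (S ⧸ a ^ m) ∘ (LinearMap.snd S S S).lTensor _) hz
  simp only [Function.comp_apply, LinearMap.lTensor_tmul, koszulD₂_apply, one_mul,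
    LinearMap.snd_apply, TensorProduct.rid_tmul, map_zero, Algebra.smul_def,
    Ideal.Quotient.algebraMap_eq, ← map_mul, Ideal.Quotient.eq_zero_iff_mem] at h
  have ht : t ∈ a ^ (m - 1) := by
    refine hx.colon_le a hm 0 ?_
    rwa [Submodule.mem_colon_singleton, smul_eq_mul, mul_comm]
  simp [Ideal.Quotient.eq_zero_iff_mem.2 ht]

end

theorem IsPrimePair.torMap_eq_zero (hx : IsPrimePair x)
    (hmax : (Ideal.span (Set.range x)).IsMaximal) (a : Ideal S) {m : ℕ} (hm : 1 ≤ m) {i : ℕ}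
    (hi : 1 ≤ i) :
    torMap (Ideal.span (Set.range x)) (Ideal.pow_le_pow_right (I := a) (Nat.sub_le m 1)) i = 0 := by
  obtain ⟨n, rfl⟩ : ∃ n, i = n + 1 := ⟨i - 1, by lia⟩
  -- Up to isomorphisms on both sides, the Tor map is the homology map of the tensored Koszul
  -- resolution.
  rw [torMap, Tor_map, hx.koszulResolution.leftDerived_app_eq]
  have h : (homologyFunctor (ModuleCat.{u} S) (ComplexShape.down ℕ) (n + 1)).map
      ((NatTrans.mapHomologicalComplex ((MonoidalCategory.tensoringLeft (ModuleCat.{u} S)).map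
        (ModuleCat.ofHom (Ideal.Quotient.factorₐ S
          (Ideal.pow_le_pow_right (I := a) (Nat.sub_le m 1))).toLinearMap))
        (ComplexShape.down ℕ)).app hx.koszulResolution.complex) = 0 := by
    refine homologyMap_eq_zero_of_forall_exists _ (n + 2) (n + 1) n (by simp) (by simp) ?_
    match n with
    | 0 =>
      intro z hz
      change ((MonoidalCategory.tensorLeft (ModuleCat.of S (S ⧸ a ^ m))).map
        ((koszulComplex x).d 1 0)).hom z = 0 at hz
      change ∃ y, ((MonoidalCategory.tensorLeft (ModuleCat.of S (S ⧸ a ^ (m - 1)))).map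
        ((koszulComplex x).d 2 1)).hom y = _
      rw [koszulComplex_d] at hz ⊢
      exact hx.exists_lTensor_koszulD₂ hmax a hm z hz
    | 1 =>
      intro z hz
      change ((MonoidalCategory.tensorLeft (ModuleCat.of S (S ⧸ a ^ m))).map
        ((koszulComplex x).d 2 1)).hom z = 0 at hz
      rw [koszulComplex_d] at hz
      exact ⟨0, (map_zero _).trans (hx.rTensor_eq_zero a hm z hz).symm⟩
    | n + 2 =>
      intro z hz
      exact ⟨0, Subsingleton.elim (α := TensorProduct S (S ⧸ a ^ (m - 1)) PUnit.{u + 1}) _ _⟩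
  rw [h, zero_comp, comp_zero]
  rfl

end Tor

/-! ### Regular local rings of dimension two. -/

section RegularLocal

variable {S : Type u} [CommRing S]

open IsLocalRing

/-- If the maximal ideal is `(y, z)`, an ideal whose quotient has dimension two
contains no power of `z` modulo `y`. -/
theorem pow_notMem_sup_span_singleton [IsLocalRing S] [IsNoetherianRing S] {Q : Ideal S}
    (hQ : ¬ ringKrullDim (S ⧸ Q) ≤ 1) {y z : S} (hyz : Ideal.span {y, z} = maximalIdeal S) (k : ℕ) :
    z ^ k ∉ Q ⊔ Ideal.span {y} := by
  intro hz
  refine hQ ?_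
  by_cases hQtop : Q = ⊤
  · have : Subsingleton (S ⧸ Q) := Ideal.Quotient.subsingleton_iff.2 hQtop
    rw [ringKrullDim_eq_bot_of_subsingleton]
    exact bot_le
  have : Nontrivial (S ⧸ Q) := Ideal.Quotient.nontrivial_iff.2 hQtop
  have : IsLocalRing (S ⧸ Q) := .of_surjective' _ Ideal.Quotient.mk_surjective
  have hmap : (maximalIdeal S).map (Ideal.Quotient.mk Q) = maximalIdeal (S ⧸ Q) :=
    IsLocalRing.map_maximalIdeal_of_surjective _ Ideal.Quotient.mk_surjective
  rw [← IsLocalRing.maximalIdeal_height_eq_ringKrullDim]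
  -- If `z ^ k ∈ Q + (y)`, a prime of `S ⧸ Q` containing `y` contains `z`; Krull's principal ideal
  -- theorem then bounds the dimension.
  suffices maximalIdeal (S ⧸ Q) ∈ (Ideal.span {Ideal.Quotient.mk Q y}).minimalPrimes from
    WithBot.coe_le_coe.2 (Ideal.height_le_one_of_isPrincipal_of_mem_minimalPrimes _ _ this)
  refine ⟨⟨inferInstance, ?_⟩, fun P hP _ => ?_⟩
  · rw [Ideal.span_singleton_le_iff_mem, ← hmap, ← hyz]
    exact Ideal.mem_map_of_mem _ (Ideal.subset_span (by simp))
  · have := hP.1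
    have hy := (Ideal.span_singleton_le_iff_mem _).1 hP.2
    rw [← hmap, ← hyz, Ideal.map_span, Ideal.span_le]
    rintro _ ⟨w, rfl | rfl, rfl⟩
    · exact hy
    · obtain ⟨q, hq, r, hr, hqr⟩ := Submodule.mem_sup.1 hz
      obtain ⟨r, rfl⟩ := Ideal.mem_span_singleton'.1 hr
      refine this.mem_of_pow_mem k ?_
      rw [← map_pow, ← hqr, map_add, Ideal.Quotient.eq_zero_iff_mem.2 hq, zero_add, map_mul]
      exact P.mul_mem_left _ hy

/-- The maximal ideal of `S ⧸ (y)` is generated by the class of `z`. Krull's intersection theorem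
gives the last power containing the class of `s`, and the cofactor there must be a unit. -/
theorem exists_isUnit_mul_pow_sub_mem [IsLocalRing S] [IsNoetherianRing S] {y z : S}
    (hyz : Ideal.span {y, z} = maximalIdeal S) {s : S} (hs : ¬ y ∣ s) :
    ∃ (k : ℕ) (u t : S), IsUnit u ∧ s = u * z ^ k + y * t := by
  have hy : y ∈ maximalIdeal S := hyz ▸ Ideal.subset_span (by simp)
  have hne : Ideal.span {y} ≠ ⊤ := fun h => by
    rw [Ideal.span_singleton_eq_top] at h
    exact hy h
  have : Nontrivial (S ⧸ Ideal.span {y}) := Ideal.Quotient.nontrivial_iff.2 hne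
  have : IsLocalRing (S ⧸ Ideal.span {y}) := .of_surjective' _ Ideal.Quotient.mk_surjective
  have hm : maximalIdeal (S ⧸ Ideal.span {y}) = Ideal.span {Ideal.Quotient.mk _ z} := by
    rw [← IsLocalRing.map_maximalIdeal_of_surjective _ Ideal.Quotient.mk_surjective, ← hyz,
      Ideal.map_span, Set.image_pair,
      Ideal.Quotient.eq_zero_iff_mem.2 (Ideal.mem_span_singleton_self y), Ideal.span_insert_zero]
  have hs0 : Ideal.Quotient.mk (Ideal.span {y}) s ≠ 0 := by
    rwa [Ne, Ideal.Quotient.eq_zero_iff_mem, Ideal.mem_span_singleton]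
  have hex : ∃ k, Ideal.Quotient.mk (Ideal.span {y}) s ∉ maximalIdeal (S ⧸ Ideal.span {y}) ^ k := by
    by_contra! h
    refine hs0 ?_
    have := Ideal.iInf_pow_eq_bot_of_isLocalRing (maximalIdeal (S ⧸ Ideal.span {y}))
      (maximalIdeal.isMaximal _).ne_top
    rw [← Ideal.mem_bot, ← this]
    exact (Submodule.mem_iInf _).2 h
  classical
  obtain ⟨k, hk⟩ : ∃ k, Nat.find hex = k + 1 := by
    refine Nat.exists_eq_succ_of_ne_zero fun h => ?_
    have := Nat.find_spec hex
    rw [h] at this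
    simp at this
  have h1 := Nat.find_spec hex
  have h2 := not_not.1 (Nat.find_min hex (by rw [hk]; exact Nat.lt_succ_self k))
  rw [hk] at h1
  rw [hm, Ideal.span_singleton_pow] at h1 h2
  obtain ⟨u, hu⟩ := Ideal.mem_span_singleton'.1 h2
  obtain ⟨u, rfl⟩ := Ideal.Quotient.mk_surjective u
  rw [← map_pow, ← map_mul, eq_comm, Ideal.Quotient.mk_eq_mk_iff_sub_mem,
    Ideal.mem_span_singleton] at hu
  obtain ⟨t, ht⟩ := hu
  refine ⟨k, u, t, ?_, by linear_combination ht⟩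
  by_contra hu
  have hu' : u ∈ maximalIdeal S := hu
  rw [← hyz] at hu'
  obtain ⟨p, q, rfl⟩ := Ideal.mem_span_pair.1 hu'
  refine h1 (Ideal.mem_span_singleton'.2 ⟨Ideal.Quotient.mk _ q, ?_⟩)
  rw [← map_pow, ← map_mul, eq_comm, Ideal.Quotient.mk_eq_mk_iff_sub_mem,
    Ideal.mem_span_singleton]
  exact ⟨t + p * z ^ k, by linear_combination ht⟩

theorem not_ringKrullDim_quotient_bot_le_one (h : ringKrullDim S = 2) :
    ¬ ringKrullDim (S ⧸ (⊥ : Ideal S)) ≤ 1 := by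
  rw [ringKrullDim_eq_of_ringEquiv (RingEquiv.quotientBot S), h]
  decide

/-- Take the bottom of a chain of primes of length two. -/
theorem exists_isPrime_not_ringKrullDim_quotient_le_one (h : ringKrullDim S = 2) :
    ∃ Q : Ideal S, Q.IsPrime ∧ ¬ ringKrullDim (S ⧸ Q) ≤ 1 := by
  have hle : ((2 : ℕ) : WithBot ℕ∞) ≤ ringKrullDim S := by rw [h]; rfl
  obtain ⟨l, hl⟩ := Order.le_krullDim_iff.1 hle
  refine ⟨l.head.asIdeal, l.head.2, fun hcon => ?_⟩
  rw [ringKrullDim_quotient] at hcon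
  let l' : LTSeries (PrimeSpectrum.zeroLocus (l.head.asIdeal : Set S)) :=
    ⟨l.length, fun i => ⟨l i, l.head_le i⟩, fun i => l.step i⟩
  have := (Order.LTSeries.length_le_krullDim l').trans hcon
  rw [show l'.length = 2 from hl] at this
  exact absurd this (by decide)

variable [IsRegularLocalRing S]

/-- Modulo `y`, two non-multiples of `y` are units times powers of `z`, hence so is their product,
and `y` divides no power of `z`. -/
theorem prime_of_span_pair_eq_maximalIdeal (h : ringKrullDim S = 2) {y z : S}
    (hyz : Ideal.span {y, z} = maximalIdeal S) : (Ideal.span {y}).IsPrime := by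
  have hpow := pow_notMem_sup_span_singleton (not_ringKrullDim_quotient_bot_le_one h) hyz
  simp only [bot_sup_eq, Ideal.mem_span_singleton] at hpow
  refine ⟨fun htop => hpow 0 ?_, fun {s t} hst => ?_⟩
  · rw [pow_zero, ← Ideal.mem_span_singleton, htop]
    trivial
  · by_contra! hcon
    simp only [Ideal.mem_span_singleton] at hst hcon
    obtain ⟨k, u, r, hu, rfl⟩ := exists_isUnit_mul_pow_sub_mem hyz hcon.1
    obtain ⟨l, v, r', hv, rfl⟩ := exists_isUnit_mul_pow_sub_mem hyz hcon.2
    refine hpow (k + l) ((hu.mul hv).dvd_mul_left.1 ?_)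
    obtain ⟨c, hc⟩ := hst
    exact ⟨c - (r * (v * z ^ l) + u * z ^ k * r' + y * r * r'), by linear_combination hc⟩

/-- For a prime `Q` with `dim S ⧸ Q ≥ 2`, one has `y ∉ Q` and `Q ⊆ (y)`. Primality gives `Q = y Q`,
so `Q = 0` by Nakayama. -/
theorem isDomain_of_isRegularLocalRing_of_ringKrullDim_eq_two (h : ringKrullDim S = 2) {y z : S}
    (hyz : Ideal.span {y, z} = maximalIdeal S) : IsDomain S := by
  obtain ⟨Q, hQ, hdim⟩ := exists_isPrime_not_ringKrullDim_quotient_le_one h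
  have hy : y ∉ Q := fun hy => by
    have := pow_notMem_sup_span_singleton hdim ((Set.pair_comm z y) ▸ hyz) 1
    exact this (by rw [pow_one]; exact Ideal.mem_sup_left hy)
  have hle : Q ≤ Ideal.span {y} := fun s hs => by
    by_contra hcon
    rw [Ideal.mem_span_singleton] at hcon
    obtain ⟨k, u, t, hu, rfl⟩ := exists_isUnit_mul_pow_sub_mem hyz hcon
    refine pow_notMem_sup_span_singleton hdim hyz k ?_
    rw [← Ideal.unit_mul_mem_iff_mem _ hu, show u * z ^ k = (u * z ^ k + y * t) - t * y by ring]
    exact sub_mem (Ideal.mem_sup_left hs)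
      (Ideal.mem_sup_right (Ideal.mul_mem_left _ _ (Ideal.mem_span_singleton_self y)))
  have hbot : Q = ⊥ := by
    refine Submodule.eq_bot_of_le_smul_of_le_jacobson_bot (Ideal.span {y}) Q
      (IsNoetherian.noetherian Q) (fun s hs => ?_) ?_
    · obtain ⟨t, rfl⟩ := Ideal.mem_span_singleton.1 (hle hs)
      exact Ideal.mul_mem_mul (Ideal.mem_span_singleton_self y)
        ((hQ.mem_or_mem hs).resolve_left hy)
    · rw [IsLocalRing.jacobson_eq_maximalIdeal _ bot_ne_top, ← hyz]
      exact Ideal.span_mono (by simp)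
  subst hbot
  exact IsDomain.of_bot_isPrime S

theorem isPrincipalIdealRing_quotient_span_singleton (h : ringKrullDim S = 2) {y z : S}
    (hyz : Ideal.span {y, z} = maximalIdeal S) : IsPrincipalIdealRing (S ⧸ Ideal.span {y}) := by
  have := prime_of_span_pair_eq_maximalIdeal h hyz
  have : IsLocalRing (S ⧸ Ideal.span {y}) := .of_surjective' _ Ideal.Quotient.mk_surjective
  have hm : (maximalIdeal (S ⧸ Ideal.span {y})).IsPrincipal := by
    rw [← IsLocalRing.map_maximalIdeal_of_surjective _ Ideal.Quotient.mk_surjective, ← hyz,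
      Ideal.map_span, Set.image_pair,
      Ideal.Quotient.eq_zero_iff_mem.2 (Ideal.mem_span_singleton_self y), Ideal.span_insert_zero]
    exact ⟨_, rfl⟩
  exact ((tfae_of_isNoetherianRing_of_isLocalRing_of_isDomain (S ⧸ Ideal.span {y})).out 0 4).2 hm

theorem isPrimePair_of_span_range_eq_maximalIdeal [IsDomain S] (h : ringKrullDim S = 2)
    {x : Fin 2 → S} (hx : Ideal.span {x 0, x 1} = maximalIdeal S) : IsPrimePair x := by
  have hx' : Ideal.span {x 1, x 0} = maximalIdeal S := by rw [Set.pair_comm, hx]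
  have hnd {y z : S} (hyz : Ideal.span {y, z} = maximalIdeal S) : ¬ y ∣ z := by
    have := pow_notMem_sup_span_singleton (not_ringKrullDim_quotient_bot_le_one h) hyz 1
    rwa [bot_sup_eq, pow_one, Ideal.mem_span_singleton] at this
  have hp {y z : S} (hyz : Ideal.span {y, z} = maximalIdeal S)
      (hzy : Ideal.span {z, y} = maximalIdeal S) : Prime y :=
    (Ideal.span_singleton_prime (fun h0 => hnd hzy (by rw [h0]; exact dvd_zero _))).1
      (prime_of_span_pair_eq_maximalIdeal h hyz)
  refine ⟨?_, hnd hx, ?_⟩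
  · exact Fin.forall_fin_two.2 ⟨hp hx hx', hp hx' hx⟩
  · exact Fin.forall_fin_two.2 ⟨isPrincipalIdealRing_quotient_span_singleton h hx,
      isPrincipalIdealRing_quotient_span_singleton h hx'⟩

end RegularLocal

/-! ### Polynomial rings in two variables. -/

section PolynomialRing

open MvPolynomial

variable {k : Type u} [Field k] {x : Fin 2 → MvPolynomial (Fin 2) k}

theorem exists_homogeneousComponent_one_mul_eq {σ : Type*} {f : MvPolynomial σ k} {e : ℕ}
    (hf : f.IsHomogeneous e) (hf0 : constantCoeff f = 0) (s : MvPolynomial σ k) :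
    ∃ c : k, homogeneousComponent 1 (s * f) = C c * f := by
  by_cases hf' : f = 0
  · exact ⟨0, by simp [hf']⟩
  have he : e ≠ 0 := by
    rintro rfl
    refine hf' ?_
    have hdeg := totalDegree_eq_zero_iff_eq_C.1 (hf.totalDegree hf')
    rwa [← constantCoeff_eq, hf0, C_0] at hdeg
  refine ⟨if e = 1 then coeff 0 s else 0, ?_⟩
  conv_lhs => rw [← sum_homogeneousComponent s, Finset.sum_mul, map_sum]
  rw [Finset.sum_eq_single_of_mem 0 (by simp) fun i _ hi => ?_]
  · rw [homogeneousComponent_of_mem ((homogeneousComponent_isHomogeneous 0 s).mul hf)]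
    by_cases h1 : e = 1
    · simp [h1]
    · rw [if_neg (by lia), if_neg h1, C_0, zero_mul]
  · rw [homogeneousComponent_of_mem ((homogeneousComponent_isHomogeneous i s).mul hf),
      if_neg (by lia)]

theorem aeval_surjective_of_isHomogeneous (hhom : ∀ j, ∃ e : ℕ, (x j).IsHomogeneous e)
    (hx : Ideal.span (Set.range x) = Ideal.span (Set.range X)) :
    Function.Surjective (aeval x : MvPolynomial (Fin 2) k →ₐ[k] MvPolynomial (Fin 2) k) := by
  have hX (i : Fin 2) : X i ∈ (aeval x : MvPolynomial (Fin 2) k →ₐ[k] _).range := by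
    have hmem : (X i : MvPolynomial (Fin 2) k) ∈ Ideal.span (Set.range x) :=
      hx ▸ Ideal.subset_span (Set.mem_range_self i)
    obtain ⟨p, q, hpq⟩ := mem_span_range_fin_two.1 hmem
    have h0 (j : Fin 2) : constantCoeff (x j) = 0 := by
      have hj : x j ∈ Ideal.span (Set.range X) := hx ▸ Ideal.subset_span (Set.mem_range_self j)
      have hle : Ideal.span (Set.range (X : Fin 2 → MvPolynomial (Fin 2) k)) ≤
          RingHom.ker (constantCoeff (R := k)) := by
        rw [Ideal.span_le]
        rintro _ ⟨l, rfl⟩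
        simp
      exact hle hj
    obtain ⟨e, he⟩ := hhom 0
    obtain ⟨e', he'⟩ := hhom 1
    obtain ⟨c, hc⟩ := exists_homogeneousComponent_one_mul_eq he (h0 0) p
    obtain ⟨c', hc'⟩ := exists_homogeneousComponent_one_mul_eq he' (h0 1) q
    -- Linear parts turn the coefficients `p`, `q` into constants, whatever the degrees of the `x
    -- j`.
    have hXi := congrArg (homogeneousComponent 1) hpq
    rw [map_add, hc, hc', homogeneousComponent_of_mem (n := 1) (isHomogeneous_X k i), if_pos rfl]
      at hXi
    exact ⟨C c * X 0 + C c' * X 1, by simp [hXi]⟩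
  rw [← AlgHom.range_eq_top, eq_top_iff, ← adjoin_range_X, Algebra.adjoin_le_iff]
  rintro _ ⟨i, rfl⟩
  exact hX i

/-- The kernels of the iterates stabilise at some `n`; writing `y = f ^ n z`, the equation `f y = 0`
puts `z` in the kernel of `f ^ n` already. -/
theorem injective_of_surjective_of_isNoetherianRing {R : Type*} [CommRing R] [IsNoetherianRing R]
    (f : R →+* R) (hf : Function.Surjective f) : Function.Injective f := by
  let K : ℕ →o Ideal R := ⟨fun n => RingHom.ker (f ^ n), monotone_nat_of_le_succ fun n y hy => by
    rw [RingHom.mem_ker] at hy ⊢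
    rw [pow_succ', RingHom.mul_def, RingHom.comp_apply, hy, map_zero]⟩
  obtain ⟨n, hn⟩ := monotone_stabilizes_iff_noetherian.2 inferInstance K
  rw [injective_iff_map_eq_zero]
  intro y hy
  have hsurj : Function.Surjective (f ^ n) := by
    rw [RingHom.coe_pow]
    exact hf.iterate n
  obtain ⟨z, rfl⟩ := hsurj y
  have hz : z ∈ K (n + 1) := by
    change (f ^ (n + 1)) z = 0
    rwa [pow_succ', RingHom.mul_def, RingHom.comp_apply]
  rw [← hn (n + 1) (Nat.le_succ n)] at hz
  exact hz

/-- As `x 0`, `x 1` generate the algebra, the quotient by `x j` is generated by the class of `x l`,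
hence is a quotient of `k[T]`. -/
theorem isPrincipalIdealRing_quotient_of_aeval_surjective
    (hx : Function.Surjective (aeval x : MvPolynomial (Fin 2) k →ₐ[k] MvPolynomial (Fin 2) k))
    {j l : Fin 2} (hjl : ∀ i, i = j ∨ i = l) :
    IsPrincipalIdealRing (MvPolynomial (Fin 2) k ⧸ Ideal.span {x j}) := by
  let π := Ideal.Quotient.mkₐ k (Ideal.span {x j})
  let f : Polynomial k →ₐ[k] MvPolynomial (Fin 2) k ⧸ Ideal.span {x j} := Polynomial.aeval (π (x l))
  let g : MvPolynomial (Fin 2) k →ₐ[k] Polynomial k :=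
    aeval (fun i => if i = j then 0 else Polynomial.X)
  have hfg : f.comp g = π.comp (aeval x) := by
    ext i
    by_cases hi : i = j
    · subst hi
      simp [g, π, Ideal.Quotient.eq_zero_iff_mem.2 (Ideal.mem_span_singleton_self (x i))]
    · obtain rfl := (hjl i).resolve_left hi
      simp [f, g, hi, π]
  have hf : Function.Surjective f := by
    refine Function.Surjective.of_comp (g := g) ?_
    rw [← AlgHom.coe_comp, hfg, AlgHom.coe_comp]
    exact (Ideal.Quotient.mkₐ_surjective k _).comp hx
  exact IsPrincipalIdealRing.of_surjective f hf

/-- The substitution `X j ↦ x j` is an automorphism, so primality and non-divisibility carry over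
from the variables. -/
theorem isPrimePair_of_isHomogeneous (hhom : ∀ j, ∃ e : ℕ, (x j).IsHomogeneous e)
    (hx : Ideal.span (Set.range x) = Ideal.span (Set.range X)) : IsPrimePair x := by
  have hsurj := aeval_surjective_of_isHomogeneous hhom hx
  have hinj := injective_of_surjective_of_isNoetherianRing (aeval x).toRingHom hsurj
  let e : MvPolynomial (Fin 2) k ≃ₐ[k] MvPolynomial (Fin 2) k :=
    AlgEquiv.ofBijective (aeval x) ⟨hinj, hsurj⟩
  have he (j : Fin 2) : e (X j) = x j := by simp [e]
  refine ⟨fun j => ?_, fun h => ?_, Fin.forall_fin_two.2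
    ⟨isPrincipalIdealRing_quotient_of_aeval_surjective hsurj (l := 1) (by decide),
      isPrincipalIdealRing_quotient_of_aeval_surjective hsurj (l := 0) (by decide)⟩⟩
  · rw [← he, MulEquiv.prime_iff]
    exact X_prime
  · rw [← he, ← he, map_dvd_iff, X_dvd_X] at h
    simp at h

theorem isMaximal_span_range_X (σ : Type*) :
    (Ideal.span (Set.range (X : σ → MvPolynomial σ k))).IsMaximal := by
  have h : Ideal.span (Set.range (X : σ → MvPolynomial σ k)) =
      RingHom.ker (constantCoeff (R := k) (σ := σ)) := by
    ext p
    have hp := mem_pow_idealOfVars_iff' 1 p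
    rw [pow_one] at hp
    rw [hp, RingHom.mem_ker, constantCoeff_eq]
    simp [Finsupp.degree_eq_zero_iff]
  rw [h]
  exact RingHom.ker_isMaximal_of_surjective _ fun c => ⟨C c, by simp⟩

end PolynomialRing

end KoszulAR

end

theorem mainTheorem5 :
    (∀ (S : Type u) [CommRing S] [IsRegularLocalRing S], ringKrullDim S = 2 →
      ∀ x : Fin 2 → S, Ideal.span (Set.range x) = IsLocalRing.maximalIdeal S →
      ∀ a : Ideal S,
        KoszulAR.rho x a = 1 ∧
        (∀ m : ℕ, 1 ≤ m → ∀ i : ℕ, 1 ≤ i →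
          KoszulAR.torMap (IsLocalRing.maximalIdeal S)
            (Ideal.pow_le_pow_right (I := a) (Nat.sub_le m 1)) i = 0) ∧
        (∀ m : ℕ, 1 ≤ m → ∀ j : Fin 2, (a ^ m).colon {x j} ≤ a ^ (m - 1))) ∧
    (∀ (k : Type u) [Field k] (x : Fin 2 → MvPolynomial (Fin 2) k),
      (∀ j, ∃ e : ℕ, (x j).IsHomogeneous e) →
      Ideal.span (Set.range x) =
        Ideal.span (Set.range (MvPolynomial.X : Fin 2 → MvPolynomial (Fin 2) k)) →
      ∀ a : Ideal (MvPolynomial (Fin 2) k),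
        KoszulAR.rho x a = 1 ∧
        (∀ m : ℕ, 1 ≤ m → ∀ i : ℕ, 1 ≤ i →
          KoszulAR.torMap
            (Ideal.span (Set.range (MvPolynomial.X : Fin 2 → MvPolynomial (Fin 2) k)))
            (Ideal.pow_le_pow_right (I := a) (Nat.sub_le m 1)) i = 0) ∧
        (∀ m : ℕ, 1 ≤ m → ∀ j : Fin 2, (a ^ m).colon {x j} ≤ a ^ (m - 1))) := by
  refine ⟨fun S _ _ hdim x hx a => ?_, fun k _ x hhom hx a => ?_⟩
  · have hx' : Ideal.span {x 0, x 1} = IsLocalRing.maximalIdeal S := by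
      rw [← hx]
      congr 1
      ext y
      simp [Fin.exists_fin_two, eq_comm]
    have := KoszulAR.isDomain_of_isRegularLocalRing_of_ringKrullDim_eq_two hdim hx'
    have hpair := KoszulAR.isPrimePair_of_span_range_eq_maximalIdeal hdim hx'
    have hmax : (Ideal.span (Set.range x)).IsMaximal := hx ▸ IsLocalRing.maximalIdeal.isMaximal S
    refine ⟨hpair.rho_eq_one a, fun m hm i hi => ?_, fun m hm j => hpair.colon_le a hm j⟩
    rw [← hx]
    exact hpair.torMap_eq_zero hmax a hm hi
  · have hpair := KoszulAR.isPrimePair_of_isHomogeneous hhom hx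
    have hmax : (Ideal.span (Set.range x)).IsMaximal :=
      hx ▸ KoszulAR.isMaximal_span_range_X (Fin 2)
    refine ⟨hpair.rho_eq_one a, fun m hm i hi => ?_, fun m hm j => hpair.colon_le a hm j⟩
    rw [← hx]
    exact hpair.torMap_eq_zero hmax a hm hi
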